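/- Let $A$ and $\Omega$ be Polish spaces with their Borel $\sigma$-algebras, $\mu$ a Borel probability measure on $\Omega$, $\lambda>0$, and $u:A\times\Omega\to\mathbb R$ a measurable function that is bounded above. For a Borel probability measure $P$ on $A\times\Omega$ let $P_\alpha$ and $P_\omega$ denote its marginals on $A$ and $\Omega$, and put $$J(P)=\int \frac{u}{\lambda}\,dP-D_{KL}(P\,\|\,P_\alpha\otimes P_\omega)\in[-\infty,\infty).$$ Let $P$ maximize $J$ over all Borel probability measures on $A\times\Omega$ with $P_\omega=\mu$, and assume $J(P)>-\infty$. Write $\nu=P_\alpha$, $Z(\omega;\nu)=\int e^{u(\alpha,\omega)/\lambda}\,d\nu(\alpha)$, and let $P(\cdot|\alpha)$, $\alpha\in A$, be any version of the regular conditional distribution of $\omega$ given $\alpha$ under $P$. Then: (0) $a=0$ and $b(\omega)=\log Z(\omega;\nu)$ are Schrödinger potentials of $P$, that is, $a\in L^1(\nu)$, $b\in L^1(\mu)$ and $$\frac{dP}{d(\nu\otimes\mu)}(\alpha,\omega)=e^{u(\alpha,\omega)/\lambda-a(\alpha)-b(\omega)}\qquad \nu\otimes\mu\text{-a.e.}$$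 (1) (Invariant likelihood ratio) For $\nu$-a.e. $\alpha$, $$dP(\omega|\alpha)=\frac{e^{u(\alpha,\omega)/\lambda}}{Z(\omega;\nu)}\,d\mu(\omega).$$ (2) (ILR inequalities) For every $\alpha\in A$ and for $\nu$-a.e. $\alpha'$, the function $\omega\mapsto\exp\left(\frac{u(\alpha,\omega)-u(\alpha',\omega)}{\lambda}\right)$ is $P(\cdot|\alpha')$-integrable and $$\int \exp\left(\frac{u(\alpha,\omega)-u(\alpha',\omega)}{\lambda}\right)dP(\omega|\alpha')\le 1.$$ For $\nu$-a.e. $\alpha$ and for $\nu$-a.e. $\alpha'$, equality holds. -/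

import Mathlib

open MeasureTheory ProbabilityTheory

namespace RationalInattention

/-- Extended integral of a real function: integral of the positive part minus integral of the
negative part, with value in `[-∞, ∞]`. It is only used for functions that are bounded above,
integrated against probability measures, so that the first term is finite and no `∞ - ∞` occurs. -/
noncomputable def extIntegral {X : Type*} [MeasurableSpace X] (m : Measure X) (g : X → ℝ) :
    EReal :=
  ((∫⁻ x, ENNReal.ofReal (g x) ∂m : ENNReal) : EReal)
    - ((∫⁻ x, ENNReal.ofReal (-g x) ∂m : ENNReal) : EReal)

section

variable {A Ω : Type*} [MeasurableSpace A] [MeasurableSpace Ω]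

/-- The payoff of the joint law `P` of (action, state): expected utility in units of `lam`, minus
the mutual information, that is the Kullback-Leibler divergence of `P` from the product of its two
marginals. -/
noncomputable def objective (u : A → Ω → ℝ) (lam : ℝ) (P : Measure (A × Ω)) : EReal :=
  extIntegral P (fun z => u z.1 z.2 / lam)
    - ((InformationTheory.klDiv P (P.fst.prod P.snd) : ENNReal) : EReal)

/-- `P` is an optimal information policy for the prior `μ`: a probability measure on `A × Ω` with
second marginal `μ` whose payoff is maximal among all such measures. -/
structure IsOptimalPolicy (u : A → Ω → ℝ) (lam : ℝ) (μ : Measure Ω) (P : Measure (A × Ω)) :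
    Prop where
  isProbabilityMeasure : IsProbabilityMeasure P
  snd_eq : P.snd = μ
  le_objective : ∀ Q : Measure (A × Ω), IsProbabilityMeasure Q → Q.snd = μ →
    objective u lam Q ≤ objective u lam P

/-- The partition function `Z(ω; ν)`. -/
noncomputable def partitionFn (u : A → Ω → ℝ) (lam : ℝ) (ν : Measure A) (ω : Ω) : ℝ :=
  ∫ α, Real.exp (u α ω / lam) ∂ν

/-- `(a, b)` are Schrödinger potentials of `P`: they are integrable against the respective
marginals of `P`, and `exp (u / lam - a - b)` is a density of `P` with respect to the product of
its marginals. -/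
structure IsSchrodingerPotentials (u : A → Ω → ℝ) (lam : ℝ) (P : Measure (A × Ω))
    (a : A → ℝ) (b : Ω → ℝ) : Prop where
  integrable_fst : Integrable a P.fst
  integrable_snd : Integrable b P.snd
  eq_withDensity : P = (P.fst.prod P.snd).withDensity
    (fun z => ENNReal.ofReal (Real.exp (u z.1 z.2 / lam - a z.1 - b z.2)))

end

end RationalInattention

/-! Write `f = u / λ` and `q = exp f / Z`, with `Z` the normalising constant for `ν = P.fst`. By the
chain rule, the divergence of `Q` from `ν' ⊗ μ` is its mutual information plus the divergence of
`Q.fst` from `ν'`. Hence a law `Q = h · (ν' ⊗ μ)` with second marginal `μ` earns at least `∫ (f -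
log h) dQ`, whatever its true first marginal is (`integral_sub_log_le_payoff`). Each comparison with
the maximiser uses this bound.

For `h = q` the bound is formally `∫ log Z dμ`, and it exceeds the payoff of `P` by the divergence
of `P` from the Gibbs law `q · (ν ⊗ μ)`, so optimality forces the two laws to agree. Since `f` may
fail to be integrable under the Gibbs law where `Z` is near zero, that law is spliced into `P` only
over `{Z ≥ δ}` (`restrict_eq_gibbs_restrict`); these sets exhaust the states (`eq_gibbs`). The
potentials and the posteriors follow, and comparing first marginals gives `M(α) = ∫ q(α, ·) dμ = 1`
for `ν`-a.e. `α`.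

The likelihood-ratio integral equals `M(α)` for almost every `α'` (`posterior_likelihoodRatio`), so
it remains to show `M ≤ 1` everywhere. At an atom of `ν`, `M = 1` already. Otherwise, adding an atom
of weight `t` at `α` and renormalising state by state earns at least `∫ log Z + ∫ log (1 + t (X -
1))`, where `X` is a truncation of `q(α, ·)`. Optimality makes the last integral nonpositive
(`integral_log_nonpos_of_null`); `t → 0` gives `∫ X ≤ 1`, and the truncation is then removed. -/

namespace RationalInattention

/-! ### Payoffs as real integrals -/

variable {A Ω : Type*} [MeasurableSpace A] [MeasurableSpace Ω]

/-- The payoff of the joint law `Q` for a normalised utility `f` on the product space. -/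
noncomputable def payoff (f : A × Ω → ℝ) (Q : Measure (A × Ω)) : EReal :=
  extIntegral Q f - ((InformationTheory.klDiv Q (Q.fst.prod Q.snd) : ENNReal) : EReal)

lemma extIntegral_eq_integral {X : Type*} [MeasurableSpace X] {m : Measure X} {g : X → ℝ}
    (hg : Integrable g m) : extIntegral m g = ((∫ x, g x ∂m : ℝ) : EReal) := by
  have h1 : ∫⁻ x, ENNReal.ofReal (g x) ∂m ≠ ⊤ := hg.lintegral_lt_top.ne
  have h2 : ∫⁻ x, ENNReal.ofReal (-g x) ∂m ≠ ⊤ := hg.neg.lintegral_lt_top.ne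
  rw [integral_eq_lintegral_pos_part_sub_lintegral_neg_part hg, extIntegral, EReal.coe_sub,
    EReal.coe_ennreal_toReal h1, EReal.coe_ennreal_toReal h2]

lemma llr_withDensity_ofReal {X : Type*} [MeasurableSpace X] {m : Measure X} [SigmaFinite m]
    {h : X → ℝ} (hm : Measurable h) (h0 : ∀ x, 0 ≤ h x) :
    llr (m.withDensity fun x => ENNReal.ofReal (h x)) m
      =ᵐ[m.withDensity fun x => ENNReal.ofReal (h x)] fun x => Real.log (h x) := by
  have := Measure.rnDeriv_withDensity m hm.ennreal_ofReal
  filter_upwards [(withDensity_absolutelyContinuous m _).ae_le this] with x hx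
  rw [llr, hx, ENNReal.toReal_ofReal (h0 x)]

/-- Replacing the product of the marginals by any product with the same second factor can only
increase the Kullback-Leibler divergence. -/
lemma klDiv_fst_prod_snd_le [StandardBorelSpace Ω] [Nonempty Ω] (ν : Measure A)
    [IsProbabilityMeasure ν] (Q : Measure (A × Ω)) [IsProbabilityMeasure Q] :
    InformationTheory.klDiv Q (Q.fst.prod Q.snd) ≤ InformationTheory.klDiv Q (ν.prod Q.snd) := by
  -- Chain rule with a constant second kernel: the excess is the divergence of `Q.fst` from `ν`.
  have h := InformationTheory.klDiv_compProd_eq_add (μ := Q.fst) (ν := ν) (κ := Q.condKernel)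
    (η := Kernel.const A Q.snd)
  rw [Measure.compProd_const, Measure.compProd_const, Q.disintegrate] at h
  rw [h]
  exact le_add_self

/-- Here `∫ log h dQ` is the divergence of `Q` from `ν ⊗ μ`, which dominates the mutual information.
Competitors can thus be evaluated without computing their first marginal. -/
lemma integral_sub_log_le_payoff [StandardBorelSpace Ω] [Nonempty Ω] {μ : Measure Ω}
    {ν : Measure A} [IsProbabilityMeasure ν] {Q : Measure (A × Ω)} [IsProbabilityMeasure Q]
    (hQμ : Q.snd = μ) {f h : A × Ω → ℝ} (hm : Measurable h) (h0 : ∀ z, 0 ≤ h z)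
    (hQ : Q = (ν.prod μ).withDensity fun z => ENNReal.ofReal (h z)) (hf : Integrable f Q)
    (hlog : Integrable (fun z => Real.log (h z)) Q) :
    ((∫ z, (f z - Real.log (h z)) ∂Q : ℝ) : EReal) ≤ payoff f Q := by
  have : IsProbabilityMeasure μ := hQμ ▸ inferInstance
  have hllr : llr Q (ν.prod μ) =ᵐ[Q] fun z => Real.log (h z) := by
    have := llr_withDensity_ofReal (m := ν.prod μ) hm h0
    rwa [← hQ] at this
  have hac : Q ≪ ν.prod μ := hQ ▸ withDensity_absolutelyContinuous _ _
  have hint : Integrable (llr Q (ν.prod μ)) Q := hlog.congr hllr.symm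
  have hk : InformationTheory.klDiv Q (ν.prod μ) = ENNReal.ofReal (∫ z, Real.log (h z) ∂Q) := by
    rw [InformationTheory.klDiv_of_ac_of_integrable hac hint, integral_congr_ae hllr]
    simp
  have hnn : 0 ≤ ∫ z, Real.log (h z) ∂Q := by
    have := InformationTheory.integral_llr_add_sub_measure_univ_nonneg hac hint
    rw [integral_congr_ae hllr] at this
    simpa using this
  have hle := klDiv_fst_prod_snd_le ν Q
  rw [hQμ, hk] at hle
  rw [integral_sub hf hlog, EReal.coe_sub, payoff, extIntegral_eq_integral hf, hQμ]
  refine EReal.sub_le_sub le_rfl ?_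
  calc _ ≤ ((ENNReal.ofReal (∫ z, Real.log (h z) ∂Q) : ENNReal) : EReal) := by exact_mod_cast hle
    _ = _ := by rw [EReal.coe_ennreal_ofReal, max_eq_left hnn]

/-- A finite payoff gives integrability of the utility and a finite mutual information. -/
lemma payoff_ne_bot {P : Measure (A × Ω)} [IsProbabilityMeasure P] {f : A × Ω → ℝ}
    (hfm : Measurable f) {c : ℝ} (hc : ∀ z, f z ≤ c) (hP : payoff f P ≠ ⊥) :
    Integrable f P ∧ P ≪ P.fst.prod P.snd ∧ Integrable (llr P (P.fst.prod P.snd)) P ∧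
      payoff f P = ((∫ z, (f z - llr P (P.fst.prod P.snd) z) ∂P : ℝ) : EReal) := by
  have hk : InformationTheory.klDiv P (P.fst.prod P.snd) ≠ ⊤ := by
    intro h
    apply hP
    rw [payoff, h]
    simp
  have hpos : ∫⁻ z, ENNReal.ofReal (f z) ∂P ≠ ⊤ := by
    refine ne_top_of_le_ne_top ?_ (lintegral_mono fun z => ENNReal.ofReal_le_ofReal (hc z))
    simp
  have hneg : ∫⁻ z, ENNReal.ofReal (-f z) ∂P ≠ ⊤ := by
    intro h
    apply hP
    rw [payoff, extIntegral, h]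
    simp
  have hf : Integrable f P := by
    refine ⟨hfm.aestronglyMeasurable, ?_⟩
    rw [hasFiniteIntegral_iff_norm]
    calc ∫⁻ z, ENNReal.ofReal ‖f z‖ ∂P
        ≤ ∫⁻ z, (ENNReal.ofReal (f z) + ENNReal.ofReal (-f z)) ∂P := by
          refine lintegral_mono fun z => ?_
          rcases abs_cases (f z) with h | h <;> rw [Real.norm_eq_abs, h.1]
          · exact le_self_add
          · exact le_add_self
      _ = ∫⁻ z, ENNReal.ofReal (f z) ∂P + ∫⁻ z, ENNReal.ofReal (-f z) ∂P :=
          lintegral_add_left hfm.ennreal_ofReal _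
      _ < ⊤ := by simp [lt_top_iff_ne_top, hpos, hneg]
  obtain ⟨hac, hint⟩ := InformationTheory.klDiv_ne_top_iff.1 hk
  refine ⟨hf, hac, hint, ?_⟩
  have hnn := InformationTheory.integral_llr_add_sub_measure_univ_nonneg hac hint
  rw [payoff, extIntegral_eq_integral hf, integral_sub hf hint, EReal.coe_sub,
    InformationTheory.klDiv_of_ac_of_integrable hac hint, EReal.coe_ennreal_ofReal,
    max_eq_left hnn]
  simp

/-! ### Gibbs laws -/

/-- The normalising constant of the kernel `exp f` with respect to `ν`. -/
noncomputable def normConst (f : A × Ω → ℝ) (ν : Measure A) (ω : Ω) : ℝ :=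
  ∫ α, Real.exp (f (α, ω)) ∂ν

/-- The joint law with density `exp f / Z` with respect to `ν ⊗ μ`. -/
noncomputable def gibbs (f : A × Ω → ℝ) (ν : Measure A) (μ : Measure Ω) : Measure (A × Ω) :=
  (ν.prod μ).withDensity fun z => ENNReal.ofReal (Real.exp (f z) / normConst f ν z.2)

section normConst

variable {f : A × Ω → ℝ} (hfm : Measurable f) {c : ℝ} (hc : ∀ z, f z ≤ c)
  (ν : Measure A) [IsProbabilityMeasure ν] (μ : Measure Ω) [IsProbabilityMeasure μ]

include hfm

lemma measurable_normConst : Measurable (normConst f ν) :=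
  (hfm.exp.stronglyMeasurable.integral_prod_left' (μ := ν)).measurable

include hc

lemma integrable_exp_left (ω : Ω) : Integrable (fun α => Real.exp (f (α, ω))) ν := by
  refine Integrable.of_bound (hfm.exp.comp measurable_prodMk_right).aestronglyMeasurable
    (Real.exp c) (.of_forall fun α => ?_)
  rw [Real.norm_eq_abs, Real.abs_exp]
  exact Real.exp_le_exp.2 (hc _)

lemma normConst_pos (ω : Ω) : 0 < normConst f ν ω :=
  integral_exp_pos (integrable_exp_left hfm hc ν ω)

lemma normConst_le (ω : Ω) : normConst f ν ω ≤ Real.exp c := by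
  have := integral_mono (integrable_exp_left hfm hc ν ω) (integrable_const (Real.exp c))
    fun α => Real.exp_le_exp.2 (hc (α, ω))
  simpa [normConst] using this

lemma lintegral_exp_div_normConst (ω : Ω) :
    ∫⁻ α, ENNReal.ofReal (Real.exp (f (α, ω)) / normConst f ν ω) ∂ν = 1 := by
  rw [← ofReal_integral_eq_lintegral_ofReal ((integrable_exp_left hfm hc ν ω).div_const _)
    (.of_forall fun α => div_nonneg (Real.exp_nonneg _) (normConst_pos hfm hc ν ω).le),
    integral_div]
  change ENNReal.ofReal (normConst f ν ω / _) = 1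
  rw [div_self (normConst_pos hfm hc ν ω).ne', ENNReal.ofReal_one]

omit hc in
lemma measurable_gibbs_density :
    Measurable fun z : A × Ω => Real.exp (f z) / normConst f ν z.2 :=
  hfm.exp.div ((measurable_normConst hfm ν).comp measurable_snd)

lemma gibbs_snd : (gibbs f ν μ).snd = μ := by
  ext s hs
  have hm := (measurable_gibbs_density hfm ν).ennreal_ofReal
  rw [Measure.snd_apply hs, gibbs, withDensity_apply _ (measurable_snd hs),
    ← lintegral_indicator (measurable_snd hs),
    lintegral_prod_symm _ (hm.indicator (measurable_snd hs)).aemeasurable]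
  have : ∀ ω, ∫⁻ α, (Prod.snd ⁻¹' s).indicator
      (fun z : A × Ω => ENNReal.ofReal (Real.exp (f z) / normConst f ν z.2)) (α, ω) ∂ν
      = s.indicator 1 ω := by
    intro ω
    by_cases h : ω ∈ s
    · simp [Set.indicator, h, lintegral_exp_div_normConst hfm hc ν ω]
    · simp [Set.indicator, h]
  simp_rw [this]
  rw [lintegral_indicator_one hs]

lemma isProbabilityMeasure_gibbs : IsProbabilityMeasure (gibbs f ν μ) := by
  constructor
  rw [← Measure.snd_univ, gibbs_snd hfm hc, measure_univ]

end normConst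

lemma abs_mul_exp_le {x c : ℝ} (hx : x ≤ c) : |x| * Real.exp x ≤ 1 + |c| * Real.exp c := by
  rcases le_total x 0 with h | h
  · have h1 : -x + 1 ≤ Real.exp (-x) := Real.add_one_le_exp _
    have h2 : Real.exp (-x) * Real.exp x = 1 := by rw [← Real.exp_add]; simp
    have h3 := Real.exp_pos x
    have : 0 ≤ |c| * Real.exp c := by positivity
    rw [abs_of_nonpos h]
    nlinarith
  · rw [abs_of_nonneg h]
    have : x * Real.exp x ≤ |c| * Real.exp c :=
      mul_le_mul (hx.trans (le_abs_self c)) (Real.exp_le_exp.2 hx) (Real.exp_nonneg _)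
        (abs_nonneg c)
    linarith

lemma abs_log_le_of_mem_Icc {x δ c : ℝ} (hδ : 0 < δ) (h1 : δ ≤ x) (h2 : x ≤ Real.exp c) :
    |Real.log x| ≤ |Real.log δ| + |c| := by
  have a1 := Real.log_le_log hδ h1
  have a2 := Real.log_le_log (hδ.trans_le h1) h2
  rw [Real.log_exp] at a2
  rw [abs_le]
  constructor
  · linarith [neg_abs_le (Real.log δ), abs_nonneg c]
  · linarith [le_abs_self c, abs_nonneg (Real.log δ)]

/-! ### Maximisers are Gibbs laws -/

section

variable {f : A × Ω → ℝ} (hfm : Measurable f) {c : ℝ} (hc : ∀ z, f z ≤ c)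

include hfm hc

/-- An upper bound on `f` bounds `|f| * exp f`; only the division by the normalising constant can
spoil integrability, and `δ` controls it. -/
lemma integrableOn_gibbs (ν : Measure A) [IsProbabilityMeasure ν] (μ : Measure Ω)
    [IsProbabilityMeasure μ] {G : Set Ω} (hG : MeasurableSet G) {δ : ℝ} (hδ : 0 < δ)
    (hGδ : ∀ ω ∈ G, δ ≤ normConst f ν ω) :
    IntegrableOn f (Prod.snd ⁻¹' G) (gibbs f ν μ) := by
  have hS : MeasurableSet (Prod.snd ⁻¹' G : Set (A × Ω)) := measurable_snd hG
  have hqm := measurable_gibbs_density hfm ν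
  rw [IntegrableOn, gibbs, restrict_withDensity hS,
    integrable_withDensity_iff hqm.ennreal_ofReal (.of_forall fun _ => ENNReal.ofReal_lt_top)]
  refine Integrable.of_bound (hfm.mul hqm.ennreal_ofReal.ennreal_toReal).aestronglyMeasurable
    ((1 + |c| * Real.exp c) / δ) ?_
  filter_upwards [ae_restrict_mem hS] with z hz
  have hZ := normConst_pos hfm hc ν z.2
  rw [ENNReal.toReal_ofReal (div_nonneg (Real.exp_nonneg _) hZ.le), Real.norm_eq_abs, abs_mul,
    abs_div, Real.abs_exp, abs_of_pos hZ, ← mul_div_assoc]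
  have := abs_mul_exp_le (hc z)
  gcongr
  exact hGδ _ hz

/-- On any set of states where the normalising constant is bounded away from zero, a maximiser
coincides with the Gibbs law built from its own first marginal. -/
lemma restrict_eq_gibbs_restrict [StandardBorelSpace Ω] [Nonempty Ω]
    {P : Measure (A × Ω)} [IsProbabilityMeasure P]
    (hmax : ∀ Q : Measure (A × Ω), IsProbabilityMeasure Q → Q.snd = P.snd →
      payoff f Q ≤ payoff f P) (hbot : payoff f P ≠ ⊥)
    {G : Set Ω} (hG : MeasurableSet G) {δ : ℝ} (hδ : 0 < δ)
    (hGδ : ∀ ω ∈ G, δ ≤ normConst f P.fst ω) :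
    P.restrict (Prod.snd ⁻¹' G) = (gibbs f P.fst P.snd).restrict (Prod.snd ⁻¹' G) := by
  obtain ⟨hfP, hac, hint, hpay⟩ := payoff_ne_bot hfm hc hbot
  set ν := P.fst with hν
  set μ := P.snd with hμ
  set m := ν.prod μ with hm
  set Γ := gibbs f ν μ with hR
  set S : Set (A × Ω) := Prod.snd ⁻¹' G with hSdef
  have hS : MeasurableSet S := measurable_snd hG
  have hRprob : IsProbabilityMeasure Γ := isProbabilityMeasure_gibbs hfm hc ν μ
  have hRsnd : Γ.snd = μ := gibbs_snd hfm hc ν μ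
  have hZpos := normConst_pos hfm hc ν
  have hZm := measurable_normConst hfm ν
  set p : A × Ω → ℝ := fun z => (P.rnDeriv m z).toReal with hp
  set q : A × Ω → ℝ := fun z => Real.exp (f z) / normConst f ν z.2 with hq
  have hpm : Measurable p := (Measure.measurable_rnDeriv _ _).ennreal_toReal
  have hqm : Measurable q := measurable_gibbs_density hfm ν
  have hqpos : ∀ z, 0 < q z := fun z => div_pos (Real.exp_pos _) (hZpos _)
  have hlogq : ∀ z, Real.log (q z) = f z - Real.log (normConst f ν z.2) := fun z => by
    rw [Real.log_div (Real.exp_pos _).ne' (hZpos _).ne', Real.log_exp]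
  have hPp : P = m.withDensity fun z => ENNReal.ofReal (p z) := by
    conv_lhs => rw [← Measure.withDensity_rnDeriv_eq P m hac]
    refine withDensity_congr_ae ?_
    filter_upwards [Measure.rnDeriv_lt_top P m] with z hz
    rw [ENNReal.ofReal_toReal hz.ne]
  have hppos : ∀ᵐ z ∂P, 0 < p z := by
    filter_upwards [Measure.rnDeriv_pos hac, hac.ae_le (Measure.rnDeriv_lt_top P m)] with z h1 h2
    exact ENNReal.toReal_pos h1.ne' h2.ne
  have hllrp : llr P m = fun z => Real.log (p z) := rfl
  -- integrability of the logarithm of the normalising constant over `S`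
  have hlogZm : Measurable fun z : A × Ω => Real.log (normConst f ν z.2) :=
    (hZm.comp measurable_snd).log
  have hlogZ : ∀ T : Measure (A × Ω), IsFiniteMeasure T →
      IntegrableOn (fun z => Real.log (normConst f ν z.2)) S T := by
    intro T _
    refine Integrable.of_bound hlogZm.aestronglyMeasurable (|Real.log δ| + |c|) ?_
    filter_upwards [ae_restrict_mem hS] with z hz
    exact abs_log_le_of_mem_Icc hδ (hGδ _ hz) (normConst_le hfm hc ν _)
  have hlogZ_eq : ∀ T : Measure (A × Ω), T.snd = μ →
      ∫ z in S, Real.log (normConst f ν z.2) ∂T = ∫ ω in G, Real.log (normConst f ν ω) ∂μ := by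
    intro T hT
    rw [← hT, Measure.snd, setIntegral_map hG hZm.log.aestronglyMeasurable
      measurable_snd.aemeasurable]
  -- the competitor
  set h : A × Ω → ℝ := S.indicator q + Sᶜ.indicator p with hh
  have hhS : ∀ z ∈ S, h z = q z := fun z hz => by simp [hh, hz]
  have hhSc : ∀ z ∈ Sᶜ, h z = p z := fun z hz => by
    have : z ∉ S := hz
    simp [hh, this]
  have hhm : Measurable h := (hqm.indicator hS).add (hpm.indicator hS.compl)
  have hh0 : ∀ z, 0 ≤ h z := fun z => by
    by_cases hz : z ∈ S
    · rw [hhS z hz]; exact (hqpos z).le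
    · rw [hhSc z hz]; exact ENNReal.toReal_nonneg
  set Q := Γ.restrict S + P.restrict Sᶜ with hQ
  have hQh : Q = m.withDensity fun z => ENNReal.ofReal (h z) := by
    rw [hQ, hR, gibbs, restrict_withDensity hS, ← withDensity_indicator hS]
    conv_lhs => rw [hPp]
    rw [restrict_withDensity hS.compl, ← withDensity_indicator hS.compl,
      ← withDensity_add_left (hqm.ennreal_ofReal.indicator hS)]
    congr 1
    funext z
    by_cases hz : z ∈ S
    · simp [hhS z hz, hz, hq]
    · simp [hhSc z hz, hz]
  have hQsnd : Q.snd = μ := by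
    ext s hs
    have e1 : Γ (Prod.snd ⁻¹' s ∩ S) = μ (s ∩ G) := by
      rw [← hRsnd, Measure.snd_apply (hs.inter hG)]; rfl
    have e2 : P (Prod.snd ⁻¹' s ∩ Sᶜ) = μ (s \ G) := by
      rw [hμ, Measure.snd_apply (hs.diff hG)]; rfl
    rw [Measure.snd_apply hs, hQ, Measure.add_apply, Measure.restrict_apply (measurable_snd hs),
      Measure.restrict_apply (measurable_snd hs), e1, e2, measure_inter_add_sdiff _ hG]
  have hQprob : IsProbabilityMeasure Q := by
    constructor
    rw [← Measure.snd_univ, hQsnd, measure_univ]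
  have hfR : Integrable f (Γ.restrict S) := integrableOn_gibbs hfm hc ν μ hG hδ hGδ
  have hfQ : Integrable f Q := hfR.add_measure hfP.restrict
  have hlogR : (fun z => f z - Real.log (normConst f ν z.2))
      =ᵐ[Γ.restrict S] fun z => Real.log (h z) := by
    filter_upwards [ae_restrict_mem hS] with z hz
    rw [hhS z hz, hlogq]
  have hlogP : llr P m =ᵐ[P.restrict Sᶜ] fun z => Real.log (h z) := by
    filter_upwards [ae_restrict_mem hS.compl] with z hz
    rw [hhSc z hz, hllrp]
  have hlR : Integrable (fun z => Real.log (h z)) (Γ.restrict S) :=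
    (hfR.sub (hlogZ Γ inferInstance)).congr hlogR
  have hlP : Integrable (fun z => Real.log (h z)) (P.restrict Sᶜ) := hint.restrict.congr hlogP
  have key := (integral_sub_log_le_payoff hQsnd hhm hh0 hQh hfQ (hlR.add_measure hlP)).trans
    (hmax Q hQprob hQsnd)
  have iR : Integrable (fun z => f z - Real.log (h z)) (Γ.restrict S) := hfR.sub hlR
  have iP : Integrable (fun z => f z - Real.log (h z)) (P.restrict Sᶜ) := hfP.restrict.sub hlP
  have iL : Integrable (fun z => f z - llr P m z) P := hfP.sub hint
  rw [hpay, EReal.coe_le_coe_iff, hQ, integral_add_measure iR iP,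
    ← integral_add_compl hS iL] at key
  -- On `S`, `f - log h` is `log Z`, a function of the state alone, so its integral is the same
  -- under `Γ` and `P`.
  have k1 : ∫ z in S, (f z - Real.log (h z)) ∂Γ = ∫ z in S, Real.log (normConst f ν z.2) ∂P := by
    rw [hlogZ_eq P rfl, ← hlogZ_eq Γ hRsnd]
    refine integral_congr_ae ?_
    filter_upwards [hlogR] with z hz
    rw [← hz]; ring
  have k2 : ∫ z in Sᶜ, (f z - Real.log (h z)) ∂P = ∫ z in Sᶜ, (f z - llr P m z) ∂P := by
    refine integral_congr_ae ?_
    filter_upwards [hlogP] with z hz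
    rw [← hz]
  rw [k1, k2, add_le_add_iff_right] at key
  -- the divergence of the restricted measures vanishes
  have hpqm : Measurable fun z => p z / q z := hpm.div hqm
  have hPR : P.restrict S = (Γ.restrict S).withDensity fun z => ENNReal.ofReal (p z / q z) := by
    rw [hR, gibbs, restrict_withDensity hS, ← withDensity_mul _ hqm.ennreal_ofReal
      hpqm.ennreal_ofReal]
    conv_lhs => rw [hPp]
    rw [restrict_withDensity hS]
    congr 1
    funext z
    rw [Pi.mul_apply, ← ENNReal.ofReal_mul (hqpos z).le, mul_div_cancel₀ _ (hqpos z).ne']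
  have hac' : P.restrict S ≪ Γ.restrict S := hPR ▸ withDensity_absolutelyContinuous _ _
  have hllr : llr (P.restrict S) (Γ.restrict S) =ᵐ[P.restrict S]
      fun z => Real.log (normConst f ν z.2) - (f z - llr P m z) := by
    have := llr_withDensity_ofReal (m := Γ.restrict S) hpqm
      (fun z => div_nonneg ENNReal.toReal_nonneg (hqpos z).le)
    rw [← hPR] at this
    filter_upwards [this, ae_restrict_of_ae hppos] with z hz hz'
    rw [hz, Real.log_div hz'.ne' (hqpos z).ne', hlogq, hllrp]
    ring
  have hPint : Integrable (fun z => f z - llr P m z) (P.restrict S) :=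
    hfP.restrict.sub hint.restrict
  -- Both masses equal `μ G`, so the mass correction in `klDiv` cancels and `key` says exactly that
  -- the divergence is at most zero.
  have hmass : (Γ.restrict S).real Set.univ = (P.restrict S).real Set.univ := by
    rw [measureReal_def, measureReal_def, Measure.restrict_apply_univ,
      Measure.restrict_apply_univ, ← Measure.snd_apply hG, ← Measure.snd_apply hG, hRsnd]
  rw [← InformationTheory.klDiv_eq_zero_iff, InformationTheory.klDiv_of_ac_of_integrable hac'
    (((hlogZ P inferInstance).sub hPint).congr hllr.symm), hmass, add_sub_cancel_right,
    integral_congr_ae hllr, integral_sub (hlogZ P inferInstance) hPint, ENNReal.ofReal_eq_zero]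
  exact sub_nonpos.2 key

/-- A maximiser with finite payoff is the Gibbs law built from its own first marginal. -/
lemma eq_gibbs [StandardBorelSpace Ω] [Nonempty Ω]
    {P : Measure (A × Ω)} [IsProbabilityMeasure P]
    (hmax : ∀ Q : Measure (A × Ω), IsProbabilityMeasure Q → Q.snd = P.snd →
      payoff f Q ≤ payoff f P) (hbot : payoff f P ≠ ⊥) :
    P = gibbs f P.fst P.snd := by
  have hZm := measurable_normConst hfm P.fst
  -- The normalising constant is positive at every state, so these sets miss nothing.
  have hU : ⋃ n : ℕ, (Prod.snd ⁻¹' {ω | 1 / ((n : ℝ) + 1) ≤ normConst f P.fst ω} : Set (A × Ω))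
      = Set.univ := by
    rw [Set.eq_univ_iff_forall]
    intro z
    obtain ⟨n, hn⟩ := exists_nat_one_div_lt (normConst_pos hfm hc P.fst z.2)
    exact Set.mem_iUnion.2 ⟨n, hn.le⟩
  rw [Measure.ext_iff_of_iUnion_eq_univ hU]
  intro n
  exact restrict_eq_gibbs_restrict hfm hc hmax hbot (measurableSet_le measurable_const hZm)
    (by positivity : (0 : ℝ) < 1 / ((n : ℝ) + 1)) fun ω hω => hω

/-- The logarithm of the normalising constant is integrable, and its integral is the maximal
payoff. -/
lemma payoff_eq_integral_log_normConst
    {P : Measure (A × Ω)} [IsProbabilityMeasure P] (hbot : payoff f P ≠ ⊥)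
    (hP : P = gibbs f P.fst P.snd) :
    Integrable (fun ω => Real.log (normConst f P.fst ω)) P.snd ∧
      payoff f P = ((∫ ω, Real.log (normConst f P.fst ω) ∂P.snd : ℝ) : EReal) := by
  obtain ⟨hfP, hac, hint, hpay⟩ := payoff_ne_bot hfm hc hbot
  have hZpos := normConst_pos hfm hc P.fst
  have hllr : (fun z => f z - llr P (P.fst.prod P.snd) z) =ᵐ[P]
      fun z => Real.log (normConst f P.fst z.2) := by
    have := llr_withDensity_ofReal (m := P.fst.prod P.snd) (measurable_gibbs_density hfm P.fst)
      (fun z => div_nonneg (Real.exp_nonneg _) (hZpos z.2).le)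
    change llr (gibbs f P.fst P.snd) _ =ᵐ[gibbs f P.fst P.snd] _ at this
    rw [← hP] at this
    filter_upwards [this] with z hz
    rw [hz, Real.log_div (Real.exp_pos _).ne' (hZpos _).ne', Real.log_exp]
    ring
  have hm : AEStronglyMeasurable (fun ω => Real.log (normConst f P.fst ω)) (P.map Prod.snd) :=
    (measurable_normConst hfm P.fst).log.aestronglyMeasurable
  constructor
  · exact (integrable_map_measure hm measurable_snd.aemeasurable).2
      ((hfP.sub hint).congr hllr)
  · rw [hpay, integral_congr_ae hllr]
    congr 1
    exact (integral_map measurable_snd.aemeasurable hm).symm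

end

/-! ### First marginal and posteriors of a Gibbs law -/

section

variable {f : A × Ω → ℝ} (hfm : Measurable f) {c : ℝ} (hc : ∀ z, f z ≤ c)

include hfm

/-- If the first marginal of the Gibbs law built from `ν` is `ν`, its density has total mass one
in the second variable. -/
lemma lintegral_gibbs_density_ae (ν : Measure A) [IsProbabilityMeasure ν] (μ : Measure Ω)
    [IsProbabilityMeasure μ] (hν : (gibbs f ν μ).fst = ν) :
    ∀ᵐ α ∂ν, ∫⁻ ω, ENNReal.ofReal (Real.exp (f (α, ω)) / normConst f ν ω) ∂μ = 1 := by
  have hqm := (measurable_gibbs_density hfm ν).ennreal_ofReal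
  have hM : Measurable fun α =>
      ∫⁻ ω, ENNReal.ofReal (Real.exp (f (α, ω)) / normConst f ν ω) ∂μ := hqm.lintegral_prod_right'
  -- Both sides are the first marginal of the Gibbs law; densities with respect to a σ-finite
  -- measure are unique a.e.
  have : ν.withDensity (fun α =>
      ∫⁻ ω, ENNReal.ofReal (Real.exp (f (α, ω)) / normConst f ν ω) ∂μ) = ν.withDensity 1 := by
    rw [withDensity_one]
    conv_rhs => rw [← hν]
    ext s hs
    rw [withDensity_apply _ hs, Measure.fst_apply hs, gibbs,
      withDensity_apply _ (measurable_fst hs), ← lintegral_indicator hs,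
      ← lintegral_indicator (measurable_fst hs),
      lintegral_prod _ (hqm.indicator (measurable_fst hs)).aemeasurable]
    refine lintegral_congr fun α => ?_
    by_cases h : α ∈ s <;> simp [Set.indicator, h]
  exact (withDensity_eq_iff_of_sigmaFinite hM.aemeasurable measurable_one.aemeasurable).1 this

/-- The posteriors of a Gibbs law have densities `exp f / Z`. -/
lemma posterior_ae_eq {P : Measure (A × Ω)} [IsProbabilityMeasure P]
    [MeasurableSpace.CountableOrCountablyGenerated A Ω]
    (hP : P = gibbs f P.fst P.snd) (κ : Kernel A Ω) [IsMarkovKernel κ] (hκ : P.fst ⊗ₘ κ = P) :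
    ∀ᵐ α ∂P.fst, κ α = P.snd.withDensity
      fun ω => ENNReal.ofReal (Real.exp (f (α, ω)) / normConst f P.fst ω) := by
  classical
  set ν := P.fst
  set μ := P.snd
  have hqm := (measurable_gibbs_density hfm ν).ennreal_ofReal
  have hqu : Measurable (Function.uncurry fun α ω =>
      ENNReal.ofReal (Real.exp (f (α, ω)) / normConst f ν ω)) := hqm
  have hM : Measurable fun α =>
      ∫⁻ ω, ENNReal.ofReal (Real.exp (f (α, ω)) / normConst f ν ω) ∂μ := hqm.lintegral_prod_right'
  have hM1 := lintegral_gibbs_density_ae hfm ν μ (by rw [← hP])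
  set s := {α | ∫⁻ ω, ENNReal.ofReal (Real.exp (f (α, ω)) / normConst f ν ω) ∂μ = 1} with hs_def
  have hs : MeasurableSet s := hM (measurableSet_singleton 1)
  -- The density has mass one only on `s`. Using `κ` on the `ν`-null complement makes `η` Markov, as
  -- uniqueness of the disintegration will need.
  set η := Kernel.piecewise hs (Kernel.withDensity (Kernel.const A μ) fun α ω =>
      ENNReal.ofReal (Real.exp (f (α, ω)) / normConst f ν ω)) κ with hη
  have hηs : ∀ α ∈ s, η α = μ.withDensity
      fun ω => ENNReal.ofReal (Real.exp (f (α, ω)) / normConst f ν ω) := fun α hα => by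
    rw [hη, Kernel.piecewise_apply, if_pos hα, Kernel.withDensity_apply _ hqu, Kernel.const_apply]
  have : IsMarkovKernel η := by
    refine ⟨fun α => ⟨?_⟩⟩
    by_cases hα : α ∈ s
    · rw [hηs α hα, withDensity_apply _ .univ, Measure.restrict_univ]
      exact hα
    · rw [hη, Kernel.piecewise_apply, if_neg hα, measure_univ]
  have hcomp : ν ⊗ₘ κ = ν ⊗ₘ η := by
    rw [hκ]
    ext t ht
    rw [Measure.compProd_apply ht, hP, gibbs, withDensity_apply _ ht, ← lintegral_indicator ht,
      lintegral_prod _ (hqm.indicator ht).aemeasurable]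
    refine lintegral_congr_ae ?_
    filter_upwards [hM1] with α hα
    rw [hηs α hα, withDensity_apply _ (measurable_prodMk_left ht),
      ← lintegral_indicator (measurable_prodMk_left ht)]
    rfl
  filter_upwards [Kernel.ae_eq_of_compProd_eq hcomp, hM1] with α h1 h2
  rw [h1, hηs α h2]

end

/-! ### From expected logarithms to expectations -/

lemma sub_two_mul_sq_le_log {s : ℝ} (hs : -(1 / 2) ≤ s) : s - 2 * s ^ 2 ≤ Real.log (1 + s) := by
  have h0 : 0 < 1 + s := by linarith
  refine le_trans ?_ (Real.one_sub_inv_le_log_of_pos h0)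
  have : 1 - (1 + s)⁻¹ - (s - 2 * s ^ 2) = s ^ 2 * (1 + 2 * s) / (1 + s) := by
    field_simp
    ring
  have h2 : 0 ≤ s ^ 2 * (1 + 2 * s) / (1 + s) :=
    div_nonneg (mul_nonneg (sq_nonneg _) (by linarith)) h0.le
  linarith

/-- If moving from `1` towards `X` never increases the expected logarithm, then `X` has
expectation at most one. -/
lemma integral_le_one_of_integral_log_nonpos {μ : Measure Ω} [IsProbabilityMeasure μ]
    {X : Ω → ℝ} (hX : Measurable X) {N : ℝ} (hX0 : ∀ ω, 0 ≤ X ω) (hXN : ∀ ω, X ω ≤ N)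
    (hlog : ∀ t : ℝ, 0 < t → t ≤ 1 / 2 → ∫ ω, Real.log (1 + t * (X ω - 1)) ∂μ ≤ 0) :
    ∫ ω, X ω ∂μ ≤ 1 := by
  have hXi : Integrable X μ := Integrable.of_bound hX.aestronglyMeasurable N
    (.of_forall fun ω => by rw [Real.norm_eq_abs, abs_of_nonneg (hX0 ω)]; exact hXN ω)
  have hN : 0 ≤ N := by
    obtain ⟨ω⟩ := μ.nonempty_of_neZero
    exact (hX0 ω).trans (hXN ω)
  have bound : ∀ t : ℝ, 0 < t → t ≤ 1 / 2 → ∫ ω, X ω ∂μ ≤ 1 + t * (2 * (N + 1) ^ 2) := by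
    intro t ht ht2
    have hpt : ∀ ω, t * (X ω - 1) - 2 * (t * (N + 1)) ^ 2 ≤ Real.log (1 + t * (X ω - 1)) := by
      intro ω
      have h1 : -(1 / 2) ≤ t * (X ω - 1) := by nlinarith [hX0 ω]
      refine le_trans ?_ (sub_two_mul_sq_le_log h1)
      have h2 : (X ω - 1) ^ 2 ≤ (N + 1) ^ 2 := by
        apply sq_le_sq'
        · linarith [hX0 ω]
        · linarith [hXN ω]
      rw [mul_pow, mul_pow]
      have := mul_le_mul_of_nonneg_left h2 (sq_nonneg t)
      linarith
    have hY : Measurable fun ω => Real.log (1 + t * (X ω - 1)) := by fun_prop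
    have hlogi : Integrable (fun ω => Real.log (1 + t * (X ω - 1))) μ := by
      refine Integrable.of_bound hY.aestronglyMeasurable (|Real.log (1 / 2)| + |N|)
        (.of_forall fun ω => abs_log_le_of_mem_Icc (by norm_num) ?_ ?_)
      · nlinarith [hX0 ω]
      · have := Real.add_one_le_exp N
        nlinarith [hXN ω, hX0 ω]
    have hi : Integrable (fun ω => t * (X ω - 1)) μ := (hXi.sub (integrable_const 1)).const_mul t
    have h := (integral_mono (hi.sub (integrable_const _)) hlogi hpt).trans (hlog t ht ht2)
    have e : ∫ ω, (t * (X ω - 1) - 2 * (t * (N + 1)) ^ 2) ∂μ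
        = t * (∫ ω, X ω ∂μ - 1 - t * (2 * (N + 1) ^ 2)) := by
      rw [integral_sub hi (integrable_const _), integral_const_mul,
        integral_sub hXi (integrable_const 1)]
      simp
      ring
    simp only [Pi.sub_apply] at h
    rw [e] at h
    have := nonpos_of_mul_nonpos_right h ht
    linarith
  refine le_of_forall_pos_le_add fun ε hε => ?_
  have hK : 0 < 2 * (N + 1) ^ 2 := by positivity
  -- With this `t` the second-order error is at most `ε`.
  refine (bound (min (1 / 2) (ε / (2 * (N + 1) ^ 2))) (by positivity) (min_le_left _ _)).trans ?_
  have := mul_le_mul_of_nonneg_right (min_le_right (1 / 2) (ε / (2 * (N + 1) ^ 2))) hK.le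
  rw [div_mul_cancel₀ _ hK.ne'] at this
  linarith

/-- Integration against a law on `A × Ω` whose density is taken with respect to the product of a
mixture of `ν` and a point mass with `μ`. -/
lemma lintegral_withDensity_mix_prod (ν : Measure A) [IsProbabilityMeasure ν] (μ : Measure Ω)
    [IsProbabilityMeasure μ] (a b : ENNReal) (ha : a ≠ ⊤) (hb : b ≠ ⊤) (α : A)
    {h g : A × Ω → ENNReal} (hh : Measurable h) (hg : Measurable g) :
    ∫⁻ z, g z ∂(((a • ν + b • Measure.dirac α).prod μ).withDensity h)
      = ∫⁻ ω, (a * ∫⁻ x, h (x, ω) * g (x, ω) ∂ν + b * (h (α, ω) * g (α, ω))) ∂μ := by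
  have : IsFiniteMeasure (a • ν) := ν.smul_finite ha
  have : IsFiniteMeasure (b • Measure.dirac α) := (Measure.dirac α).smul_finite hb
  rw [lintegral_withDensity_eq_lintegral_mul _ hh hg,
    lintegral_prod_symm _ (hh.mul hg).aemeasurable]
  refine lintegral_congr fun ω => ?_
  have hm : Measurable fun x => (h * g) (x, ω) := (hh.mul hg).comp measurable_prodMk_right
  rw [lintegral_add_measure, lintegral_smul_measure, lintegral_smul_measure,
    lintegral_dirac' _ hm]
  rfl

/-! ### First variation towards an arbitrary action -/

section

variable {f : A × Ω → ℝ} (hfm : Measurable f) {c : ℝ} (hc : ∀ z, f z ≤ c)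

include hfm hc

set_option maxHeartbeats 1000000 in
/-- First variation of the payoff in the direction of an action that is not an atom of the first
marginal, on the states where the competitor is bounded. -/
lemma integral_log_nonpos_of_null [MeasurableSingletonClass A] [StandardBorelSpace Ω] [Nonempty Ω]
    {P : Measure (A × Ω)} [IsProbabilityMeasure P]
    (hmax : ∀ Q : Measure (A × Ω), IsProbabilityMeasure Q → Q.snd = P.snd →
      payoff f Q ≤ payoff f P) (hbot : payoff f P ≠ ⊥)
    (α : A) (hα : P.fst {α} = 0) {G : Set Ω} (hG : MeasurableSet G) {N : ℝ}
    (hGX : ∀ ω ∈ G, Real.exp (f (α, ω)) / normConst f P.fst ω ≤ N)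
    (hGf : ∀ ω ∈ G, |f (α, ω)| ≤ N) (hN : 0 ≤ N) {t : ℝ} (ht : 0 < t) (ht2 : t ≤ 1 / 2) :
    ∫ ω, Real.log (1 + t * (G.indicator
      (fun ω => Real.exp (f (α, ω)) / normConst f P.fst ω) ω - 1)) ∂P.snd ≤ 0 := by
  classical
  have hP := eq_gibbs hfm hc hmax hbot
  obtain ⟨hlogZ, hpay⟩ := payoff_eq_integral_log_normConst hfm hc hbot hP
  obtain ⟨hfP, -, -, -⟩ := payoff_ne_bot hfm hc hbot
  set ν := P.fst with hν
  set μ := P.snd with hμ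
  have hZpos := normConst_pos hfm hc ν
  have hZm := measurable_normConst hfm ν
  set q : A × Ω → ℝ := fun z => Real.exp (f z) / normConst f ν z.2 with hq
  have hqm : Measurable q := measurable_gibbs_density hfm ν
  have hqpos : ∀ z, 0 < q z := fun z => div_pos (Real.exp_pos _) (hZpos _)
  set X : Ω → ℝ := G.indicator (fun ω => Real.exp (f (α, ω)) / normConst f ν ω) with hX
  have hXG : ∀ ω ∈ G, X ω = q (α, ω) := fun ω hω => by simp [hX, hω, hq]
  have hXGc : ∀ ω, ω ∉ G → X ω = 0 := fun ω hω => by simp [hX, hω]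
  have hXm : Measurable X := (hqm.comp measurable_prodMk_left).indicator hG
  have hX0 : ∀ ω, 0 ≤ X ω := fun ω => by
    by_cases h : ω ∈ G
    · rw [hXG ω h]; exact (hqpos _).le
    · rw [hXGc ω h]
  have hXN : ∀ ω, X ω ≤ N := fun ω => by
    by_cases h : ω ∈ G
    · rw [hXG ω h]; exact hGX ω h
    · rw [hXGc ω h]; exact hN
  -- `Y = (1 - t) + t * X` is the mass over each state before renormalisation; `t ≤ 1 / 2` keeps it
  -- at least `1 / 2`.
  set Y : Ω → ℝ := fun ω => 1 + t * (X ω - 1) with hY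
  have hYm : Measurable Y := by fun_prop
  have hYhalf : ∀ ω, 1 / 2 ≤ Y ω := fun ω => by
    have := mul_nonneg ht.le (hX0 ω)
    simp only [hY]
    linarith
  have hYpos : ∀ ω, 0 < Y ω := fun ω => by linarith [hYhalf ω]
  have hYle : ∀ ω, Y ω ≤ Real.exp N := fun ω => by
    have := Real.add_one_le_exp N
    have h1 : t * (X ω - 1) ≤ N := by nlinarith [hX0 ω, hXN ω]
    simp only [hY]
    linarith
  have hlogY : Integrable (fun ω => Real.log (Y ω)) μ :=
    Integrable.of_bound hYm.log.aestronglyMeasurable _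
      (.of_forall fun ω => abs_log_le_of_mem_Icc (by norm_num) (hYhalf ω) (hYle ω))
  -- the competitor
  set h : A × Ω → ℝ := fun z => (if z.1 = α then X z.2 else q z) / Y z.2 with hh
  have hhm : Measurable h := by
    refine Measurable.div ?_ (hYm.comp measurable_snd)
    exact Measurable.ite (measurable_fst (measurableSet_singleton α)) (hXm.comp measurable_snd) hqm
  have hh0 : ∀ z, 0 ≤ h z := fun z => by
    refine div_nonneg ?_ (hYpos _).le
    split_ifs
    exacts [hX0 _, (hqpos _).le]
  set νt : Measure A := ENNReal.ofReal (1 - t) • ν + ENNReal.ofReal t • Measure.dirac α with hνt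
  have h1t : 0 ≤ 1 - t := by linarith
  have hνtp : IsProbabilityMeasure νt := by
    constructor
    simp only [hνt, Measure.add_apply, Measure.smul_apply, measure_univ, smul_eq_mul, mul_one]
    rw [← ENNReal.ofReal_add h1t ht.le, sub_add_cancel, ENNReal.ofReal_one]
  set Q : Measure (A × Ω) := (νt.prod μ).withDensity fun z => ENNReal.ofReal (h z) with hQ
  -- Since `α` is `ν`-null, changing the density at `α` leaves the `ν`-part of the mixture
  -- untouched.
  have hae : ∀ᵐ x ∂ν, x ≠ α := by rw [ae_iff]; simpa using hα
  have hQint : ∀ g : A × Ω → ENNReal, Measurable g → ∫⁻ z, g z ∂Q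
      = ∫⁻ ω, ENNReal.ofReal (1 / Y ω) *
        (ENNReal.ofReal (1 - t) * ∫⁻ x, ENNReal.ofReal (q (x, ω)) * g (x, ω) ∂ν
        + ENNReal.ofReal t * (ENNReal.ofReal (X ω) * g (α, ω))) ∂μ := by
    intro g hg
    rw [hQ, hνt, lintegral_withDensity_mix_prod ν μ _ _ ENNReal.ofReal_ne_top
      ENNReal.ofReal_ne_top α hhm.ennreal_ofReal hg]
    refine lintegral_congr fun ω => ?_
    have e0 : 0 ≤ 1 / Y ω := one_div_nonneg.2 (hYpos ω).le
    have e1 : ∫⁻ x, ENNReal.ofReal (h (x, ω)) * g (x, ω) ∂ν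
        = ENNReal.ofReal (1 / Y ω) * ∫⁻ x, ENNReal.ofReal (q (x, ω)) * g (x, ω) ∂ν := by
      rw [← lintegral_const_mul' _ _ ENNReal.ofReal_ne_top]
      refine lintegral_congr_ae ?_
      filter_upwards [hae] with x hx
      simp only [hh, if_neg hx]
      rw [div_eq_mul_one_div, mul_comm (q _), ENNReal.ofReal_mul e0, mul_assoc]
    have e2 : ENNReal.ofReal (h (α, ω)) = ENNReal.ofReal (1 / Y ω) * ENNReal.ofReal (X ω) := by
      simp only [hh, if_true]
      rw [div_eq_mul_one_div, mul_comm (X _), ENNReal.ofReal_mul e0]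
    rw [e1, e2]
    ring
  have hQsnd : Q.snd = μ := by
    ext s hs
    rw [Measure.snd_apply hs, ← lintegral_indicator_one (measurable_snd hs),
      hQint _ (measurable_one.indicator (measurable_snd hs)), ← lintegral_indicator_one hs]
    refine lintegral_congr fun ω => ?_
    by_cases hω : ω ∈ s
    · have e : ∫⁻ x, ENNReal.ofReal (q (x, ω)) ∂ν = 1 :=
        lintegral_exp_div_normConst hfm hc ν ω
      simp only [Set.indicator, Set.mem_preimage, hω, if_true, Pi.one_apply, mul_one, e]
      rw [← ENNReal.ofReal_mul ht.le, ← ENNReal.ofReal_add h1t (mul_nonneg ht.le (hX0 ω)),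
        ← ENNReal.ofReal_mul (one_div_nonneg.2 (hYpos ω).le)]
      have : 1 - t + t * X ω = Y ω := by simp only [hY]; ring
      rw [this, one_div_mul_cancel (hYpos ω).ne', ENNReal.ofReal_one]
    · simp [Set.indicator, hω]
  have hQprob : IsProbabilityMeasure Q := by
    constructor
    rw [← Measure.snd_univ, hQsnd, measure_univ]
  have hfQ : Integrable f Q := by
    refine ⟨hfm.aestronglyMeasurable, ?_⟩
    rw [hasFiniteIntegral_iff_norm, hQint _ hfm.norm.ennreal_ofReal]
    have hfin : ∫⁻ ω, ∫⁻ x, ENNReal.ofReal (q (x, ω)) * ENNReal.ofReal ‖f (x, ω)‖ ∂ν ∂μ ≠ ⊤ := by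
      have h1 := (hasFiniteIntegral_iff_norm f).1 hfP.2
      rw [hP, gibbs, lintegral_withDensity_eq_lintegral_mul _ hqm.ennreal_ofReal
        hfm.norm.ennreal_ofReal, lintegral_prod_symm _
        (hqm.ennreal_ofReal.mul hfm.norm.ennreal_ofReal).aemeasurable] at h1
      exact h1.ne
    -- The factor 2 bounds `1 / Y`; the truncation to `G` bounds the contribution of the atom by `N
    -- * N`.
    calc _ ≤ ∫⁻ ω, ENNReal.ofReal 2 *
          (∫⁻ x, ENNReal.ofReal (q (x, ω)) * ENNReal.ofReal ‖f (x, ω)‖ ∂ν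
          + ENNReal.ofReal N * ENNReal.ofReal N) ∂μ := by
          refine lintegral_mono fun ω => ?_
          refine mul_le_mul' (ENNReal.ofReal_le_ofReal ?_) (add_le_add ?_ ?_)
          · rw [div_le_iff₀ (hYpos ω)]
            linarith [hYhalf ω]
          · refine mul_le_of_le_one_left' ?_
            rw [← ENNReal.ofReal_one]
            exact ENNReal.ofReal_le_ofReal (by linarith)
          · refine (mul_le_of_le_one_left' ?_).trans ?_
            · rw [← ENNReal.ofReal_one]
              exact ENNReal.ofReal_le_ofReal (by linarith)
            · by_cases hω : ω ∈ G
              · exact mul_le_mul' (ENNReal.ofReal_le_ofReal (hXN ω))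
                  (ENNReal.ofReal_le_ofReal (hGf ω hω))
              · simp [hXGc ω hω]
      _ < ⊤ := by
          rw [lintegral_const_mul' _ _ ENNReal.ofReal_ne_top, lintegral_add_right _
            measurable_const, lintegral_const, measure_univ, mul_one]
          exact ENNReal.mul_lt_top ENNReal.ofReal_lt_top (ENNReal.add_lt_top.2
            ⟨hfin.lt_top, ENNReal.mul_lt_top ENNReal.ofReal_lt_top ENNReal.ofReal_lt_top⟩)
  have hlogh : (fun z => f z - (Real.log (normConst f ν z.2) + Real.log (Y z.2)))
      =ᵐ[Q] fun z => Real.log (h z) := by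
    rw [hQ, Filter.EventuallyEq, ae_withDensity_iff hhm.ennreal_ofReal]
    refine .of_forall fun z hz => ?_
    have hz0 : 0 < h z := ENNReal.ofReal_pos.1 (pos_iff_ne_zero.2 hz)
    -- Outside `G` the density vanishes at `α`, so such points are excluded by `hz0`; everywhere
    -- else `h = q / Y`.
    have e : h z = q z / Y z.2 := by
      obtain ⟨x, ω⟩ := z
      simp only [hh]
      split_ifs with hx
      · subst hx
        by_cases hω : ω ∈ G
        · rw [hXG ω hω]
        · simp [hh, hXGc ω hω] at hz0
      · rfl
    rw [e, Real.log_div (hqpos z).ne' (hYpos _).ne', hq,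
      Real.log_div (Real.exp_pos _).ne' (hZpos _).ne', Real.log_exp]
    ring
  have hsndi : ∀ k : Ω → ℝ, Integrable k μ → Integrable (fun z => k z.2) Q := by
    intro k hk
    rw [← hQsnd] at hk
    exact hk.comp_measurable measurable_snd
  have hsum : Integrable (fun z : A × Ω => Real.log (normConst f ν z.2) + Real.log (Y z.2)) Q :=
    (hsndi _ hlogZ).add (hsndi _ hlogY)
  have key := (integral_sub_log_le_payoff hQsnd hhm hh0 hQ hfQ
    ((hfQ.sub hsum).congr hlogh)).trans (hmax Q hQprob hQsnd)
  have hval : ∫ z, (f z - Real.log (h z)) ∂Q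
      = ∫ ω, Real.log (normConst f ν ω) ∂μ + ∫ ω, Real.log (Y ω) ∂μ := by
    rw [← integral_add hlogZ hlogY]
    conv_rhs => rw [← hQsnd]
    have hm : Measurable fun ω => Real.log (normConst f ν ω) + Real.log (Y ω) :=
      hZm.log.add hYm.log
    rw [Measure.snd, integral_map measurable_snd.aemeasurable hm.aestronglyMeasurable]
    refine integral_congr_ae ?_
    filter_upwards [hlogh] with z hz
    rw [← hz, sub_sub_cancel]
  rw [hpay, EReal.coe_le_coe_iff, hval] at key
  linarith

/-- The likelihood-ratio inequality for an arbitrary action. -/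
lemma lintegral_gibbs_density_le_one [MeasurableSingletonClass A] [StandardBorelSpace Ω]
    [Nonempty Ω] {P : Measure (A × Ω)} [IsProbabilityMeasure P]
    (hmax : ∀ Q : Measure (A × Ω), IsProbabilityMeasure Q → Q.snd = P.snd →
      payoff f Q ≤ payoff f P) (hbot : payoff f P ≠ ⊥) (α : A) :
    ∫⁻ ω, ENNReal.ofReal (Real.exp (f (α, ω)) / normConst f P.fst ω) ∂P.snd ≤ 1 := by
  have hP := eq_gibbs hfm hc hmax hbot
  have hXm : Measurable fun ω => Real.exp (f (α, ω)) / normConst f P.fst ω :=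
    (measurable_gibbs_density hfm P.fst).comp measurable_prodMk_left
  have hX0 : ∀ ω, 0 ≤ Real.exp (f (α, ω)) / normConst f P.fst ω := fun ω =>
    div_nonneg (Real.exp_nonneg _) (normConst_pos hfm hc P.fst ω).le
  by_cases hα : P.fst {α} = 0
  · set G : ℕ → Set Ω := fun n =>
      {ω | Real.exp (f (α, ω)) / normConst f P.fst ω ≤ n} ∩ {ω | |f (α, ω)| ≤ n} with hGdef
    have hG : ∀ n, MeasurableSet (G n) := fun n =>
      (measurableSet_le hXm measurable_const).inter
        (measurableSet_le (hfm.comp measurable_prodMk_left).norm measurable_const)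
    have hGmono : Monotone G := fun n k hnk => by
      have hnk' : (n : ℝ) ≤ k := Nat.cast_le.2 hnk
      rintro ω ⟨h1, h2⟩
      simp only [hGdef, Set.mem_inter_iff, Set.mem_ofPred_eq] at h1 h2 ⊢
      exact ⟨h1.trans hnk', h2.trans hnk'⟩
    have hU : ⋃ n, G n = Set.univ := by
      rw [Set.eq_univ_iff_forall]
      intro ω
      obtain ⟨n, hn⟩ := exists_nat_ge
        (max (Real.exp (f (α, ω)) / normConst f P.fst ω) |f (α, ω)|)
      exact Set.mem_iUnion.2 ⟨n, (le_max_left _ _).trans hn, (le_max_right _ _).trans hn⟩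
    -- Monotone convergence: it suffices to bound the integral over each `G n`.
    rw [← setLIntegral_univ, ← hU, setLIntegral_iUnion_of_directed _ hGmono.directed_le]
    refine iSup_le fun n => ?_
    have hb0 : ∀ ω, 0 ≤ (G n).indicator
        (fun ω => Real.exp (f (α, ω)) / normConst f P.fst ω) ω := fun ω =>
      Set.indicator_nonneg (fun ω _ => hX0 ω) ω
    have hbn : ∀ ω, (G n).indicator
        (fun ω => Real.exp (f (α, ω)) / normConst f P.fst ω) ω ≤ n := fun ω =>
      Set.indicator_le' (fun ω hω => hω.1) (fun _ _ => Nat.cast_nonneg n) ω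
    have hint := integral_le_one_of_integral_log_nonpos (μ := P.snd) (hXm.indicator (hG n)) hb0 hbn
      fun t ht ht2 => integral_log_nonpos_of_null hfm hc hmax hbot α hα (hG n) (fun ω hω => hω.1)
        (fun ω hω => hω.2) (Nat.cast_nonneg n) ht ht2
    have hi : Integrable ((G n).indicator
        (fun ω => Real.exp (f (α, ω)) / normConst f P.fst ω)) P.snd :=
      Integrable.of_bound (hXm.indicator (hG n)).aestronglyMeasurable n
        (.of_forall fun ω => by rw [Real.norm_eq_abs, abs_of_nonneg (hb0 ω)]; exact hbn ω)
    rw [integral_indicator (hG n)] at hint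
    rw [← ofReal_integral_eq_lintegral_ofReal ((integrable_indicator_iff (hG n)).1 hi)
      (.of_forall hX0), ← ENNReal.ofReal_one]
    exact ENNReal.ofReal_le_ofReal hint
  · have hM := lintegral_gibbs_density_ae hfm P.fst P.snd (by rw [← hP])
    by_contra hne
    refine hα (measure_mono_null ?_ (ae_iff.1 hM))
    rintro x rfl hx
    exact hne hx.le

end

/-- The factor `exp (f (α', ω))` of the posterior density cancels against the likelihood ratio, so
the value does not depend on `α'`. -/
lemma posterior_likelihoodRatio {f : A × Ω → ℝ} (hfm : Measurable f) {c : ℝ} (hc : ∀ z, f z ≤ c)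
    (ν : Measure A) [IsProbabilityMeasure ν] (μ : Measure Ω) (α α' : A)
    (hα : ∫⁻ ω, ENNReal.ofReal (Real.exp (f (α, ω)) / normConst f ν ω) ∂μ ≤ 1)
    {m : Measure Ω} (hm : m = μ.withDensity
      fun ω => ENNReal.ofReal (Real.exp (f (α', ω)) / normConst f ν ω)) :
    Integrable (fun ω => Real.exp (f (α, ω) - f (α', ω))) m ∧
      ∫ ω, Real.exp (f (α, ω) - f (α', ω)) ∂m
        = (∫⁻ ω, ENNReal.ofReal (Real.exp (f (α, ω)) / normConst f ν ω) ∂μ).toReal := by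
  have hqm : ∀ x : A, Measurable fun ω => Real.exp (f (x, ω)) / normConst f ν ω := fun x =>
    (measurable_gibbs_density hfm ν).comp measurable_prodMk_left
  have hq0 : ∀ x ω, 0 ≤ Real.exp (f (x, ω)) / normConst f ν ω := fun x ω =>
    div_nonneg (Real.exp_nonneg _) (normConst_pos hfm hc ν ω).le
  have hkm : Measurable fun ω => Real.exp (f (α, ω) - f (α', ω)) :=
    ((hfm.comp measurable_prodMk_left).sub (hfm.comp measurable_prodMk_left)).exp
  have hl : ∫⁻ ω, ENNReal.ofReal (Real.exp (f (α, ω) - f (α', ω))) ∂m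
      = ∫⁻ ω, ENNReal.ofReal (Real.exp (f (α, ω)) / normConst f ν ω) ∂μ := by
    rw [hm, lintegral_withDensity_eq_lintegral_mul _ (hqm α').ennreal_ofReal hkm.ennreal_ofReal]
    refine lintegral_congr fun ω => ?_
    rw [Pi.mul_apply, ← ENNReal.ofReal_mul (hq0 α' ω), div_mul_eq_mul_div, ← Real.exp_add,
      add_sub_cancel]
  refine ⟨?_, ?_⟩
  · refine (lintegral_ofReal_ne_top_iff_integrable hkm.aestronglyMeasurable
      (.of_forall fun ω => Real.exp_nonneg _)).1 ?_
    rw [hl]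
    exact (hα.trans_lt ENNReal.one_lt_top).ne
  · rw [integral_eq_lintegral_of_nonneg_ae (.of_forall fun ω => Real.exp_nonneg _)
      hkm.aestronglyMeasurable, hl]

end RationalInattention

theorem mainTheorem8 {A Ω : Type*}
    [TopologicalSpace A] [PolishSpace A] [MeasurableSpace A] [BorelSpace A]
    [TopologicalSpace Ω] [PolishSpace Ω] [MeasurableSpace Ω] [BorelSpace Ω]
    (μ : Measure Ω) [IsProbabilityMeasure μ]
    (u : A → Ω → ℝ) (hu : Measurable (Function.uncurry u))
    (ubar : ℝ) (hubar : ∀ α ω, u α ω ≤ ubar)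
    (lam : ℝ) (hlam : 0 < lam)
    (P : Measure (A × Ω)) (hP : RationalInattention.IsOptimalPolicy u lam μ P)
    (hfin : RationalInattention.objective u lam P ≠ ⊥)
    -- `κ α` is the posterior `P(dω | α)`; `κ` is an arbitrary version of the disintegration of `P`
    (κ : Kernel A Ω) [IsMarkovKernel κ] (hκ : P.fst ⊗ₘ κ = P) :
    RationalInattention.IsSchrodingerPotentials u lam P (fun _ => 0)
        (fun ω => Real.log (RationalInattention.partitionFn u lam P.fst ω)) ∧
    (∀ᵐ α ∂P.fst, κ α = μ.withDensity (fun ω => ENNReal.ofReal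
        (Real.exp (u α ω / lam) / RationalInattention.partitionFn u lam P.fst ω))) ∧
    (∀ α : A, ∀ᵐ α' ∂P.fst,
        Integrable (fun ω => Real.exp ((u α ω - u α' ω) / lam)) (κ α') ∧
        ∫ ω, Real.exp ((u α ω - u α' ω) / lam) ∂(κ α') ≤ 1) ∧
    (∀ᵐ α ∂P.fst, ∀ᵐ α' ∂P.fst,
        ∫ ω, Real.exp ((u α ω - u α' ω) / lam) ∂(κ α') = 1) := by
  open RationalInattention in
  have := hP.isProbabilityMeasure
  have : Nonempty Ω := μ.nonempty_of_neZero
  obtain rfl : P.snd = μ := hP.snd_eq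
  set f : A × Ω → ℝ := fun z => u z.1 z.2 / lam with hf
  have hfm : Measurable f := hu.div_const lam
  have hc : ∀ z, f z ≤ ubar / lam := fun z => by
    simp only [hf]
    gcongr
    exact hubar _ _
  have hbot : payoff f P ≠ ⊥ := hfin
  have hmax : ∀ Q : Measure (A × Ω), IsProbabilityMeasure Q → Q.snd = P.snd →
      payoff f Q ≤ payoff f P := hP.le_objective
  have hgibbs := eq_gibbs hfm hc hmax hbot
  have hZ : partitionFn u lam P.fst = normConst f P.fst := rfl
  have hpost := posterior_ae_eq hfm hgibbs κ hκ
  have hle := lintegral_gibbs_density_le_one hfm hc hmax hbot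
  have hexp : ∀ α α' ω, Real.exp ((u α ω - u α' ω) / lam)
      = Real.exp (f (α, ω) - f (α', ω)) := fun α α' ω => by rw [sub_div]
  simp only [hexp, hZ]
  refine ⟨⟨integrable_const 0, (payoff_eq_integral_log_normConst hfm hc hbot hgibbs).1, ?_⟩,
    hpost, fun α => ?_, ?_⟩
  · conv_lhs => rw [hgibbs, gibbs]
    congr 1
    funext z
    rw [sub_zero, Real.exp_sub, Real.exp_log (normConst_pos hfm hc P.fst z.2)]
  · filter_upwards [hpost] with α' hα'
    obtain ⟨h1, h2⟩ := posterior_likelihoodRatio hfm hc P.fst P.snd α α' (hle α) hα'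
    refine ⟨h1, ?_⟩
    rw [h2]
    -- The bound `hle` holds at every `α`; only the posterior formula at `α'` excludes a null set.
    exact ENNReal.toReal_le_of_le_ofReal zero_le_one (by simpa using hle α)
  · filter_upwards [lintegral_gibbs_density_ae hfm P.fst P.snd (by rw [← hgibbs])] with α hα
    filter_upwards [hpost] with α' hα'
    rw [(posterior_likelihoodRatio hfm hc P.fst P.snd α α' (hle α) hα').2, hα, ENNReal.toReal_one]
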